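/- Let $m,n,s\ge 0$ be integers, let $\mathbf Y\subset\mathbb R^n$ be compact, and let $h,\psi_1,\dots,\psi_s:\mathbb R^m\to\mathbb R$ be continuous convex functions. Let $p:\mathbb R^m\times\mathbb R^n\to\mathbb R$ be a lower semicontinuous function such that $p(\cdot,y)$ is continuous and convex for every $y\in\mathbf Y$ and $p(x,\cdot)$ is continuous on $\mathbb R^n$ for every $x\in\mathbb R^m$. Assume that the feasible region $$\mathbf K=\{x\in\mathbb R^m:\ \psi_j(x)\le 0\ (j=1,\dots,s),\ p(x,y)\le 0\ \text{for all } y\in\mathbf Y\}$$ is nonempty. For $f:\mathbb R^m\to\mathbb R$ let $f^*(\xi)=\sup_{x\in\mathbb R^m}\{\langle\xi,x\rangle-f(x)\}\in\mathbb R\cup\{+\infty\}$ be its conjugate, and let $\operatorname{epi} f^*=\{(\xi,\alpha)\in\mathbb R^m\times\mathbb R:\ f^*(\xi)\le\alpha\}$. Let $\mathcal M(\mathbf Y)$ be the set of finite nonnegative Borel measures supported on $\mathbf Y$, and put $$\mathcal C_1=\bigcup_{\mu\in\mathcal M(\mathbf Y)}\operatorname{epi}\Big(\int_{\mathbf Y}p(\cdot,y)\,d\mu(y)\Big)^*,\qquad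 \mathcal C_2=\bigcup_{\eta\in\mathbb R_+^s}\operatorname{epi}\Big(\sum_{j=1}^s\eta_j\psi_j\Big)^*.$$ Then exactly one of the following two statements holds: (i) there exists $x\in\mathbb R^m$ with $h(x)<0$, $\psi_j(x)\le 0$ for $j=1,\dots,s$, and $p(x,y)\le 0$ for all $y\in\mathbf Y$; (ii) $(0,0)\in\operatorname{epi}h^*+\operatorname{cl}(\mathcal C_1+\mathcal C_2)$, where $\operatorname{cl}$ denotes the closure in $\mathbb R^m\times\mathbb R$. -/

import Mathlib

open MeasureTheory
open scoped Pointwise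

noncomputable section

/-- The Euclidean space `ℝᵏ`. -/
abbrev Euc (k : ℕ) : Type := EuclideanSpace ℝ (Fin k)

/-- The conjugate `f*(ξ) = sup_x (⟨ξ, x⟩ - f x)` of an extended-real-valued function on `ℝᵐ`. -/
def conjugate {m : ℕ} (f : Euc m → EReal) (ξ : Euc m) : EReal :=
  ⨆ x : Euc m, ((inner ℝ ξ x : ℝ) : EReal) - f x

/-- The epigraph of an extended-real-valued function on `ℝᵐ`, a subset of `ℝᵐ × ℝ`. -/
def epigraph {m : ℕ} (f : Euc m → EReal) : Set (Euc m × ℝ) :=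
  {q | f q.1 ≤ (q.2 : EReal)}

/-- `epi f*` for a finite-valued function `f` on `ℝᵐ`. -/
def epiConj {m : ℕ} (f : Euc m → ℝ) : Set (Euc m × ℝ) :=
  epigraph (conjugate fun x => (f x : EReal))

/-- The finite nonnegative Borel measures on `ℝⁿ` that are supported on `Y`. -/
def measuresOn {n : ℕ} (Y : Set (Euc n)) : Set (Measure (Euc n)) :=
  {μ | IsFiniteMeasure μ ∧ μ Yᶜ = 0}

/-- The union of `epi (∫_Y p(·, y) dμ(y))*` over all finite nonnegative measures `μ` on `Y`. -/
def coneC₁ {m n : ℕ} (p : Euc m → Euc n → ℝ) (Y : Set (Euc n)) : Set (Euc m × ℝ) :=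
  ⋃ μ ∈ measuresOn Y, epiConj fun x => ∫ y in Y, p x y ∂μ

/-- The union of `epi (∑ⱼ ηⱼ ψⱼ)*` over all `η ∈ ℝˢ` with nonnegative entries. -/
def coneC₂ {m s : ℕ} (ψ : Fin s → Euc m → ℝ) : Set (Euc m × ℝ) :=
  ⋃ η ∈ {η : Fin s → ℝ | ∀ j, 0 ≤ η j}, epiConj fun x => ∑ j, η j * ψ j x

/-- The feasible region: all `x` with `ψⱼ(x) ≤ 0` for every `j` and `p(x, y) ≤ 0` for every
`y ∈ Y`. -/
def feasibleSet {m n s : ℕ} (ψ : Fin s → Euc m → ℝ) (p : Euc m → Euc n → ℝ)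
    (Y : Set (Euc n)) : Set (Euc m) :=
  {x | (∀ j, ψ j x ≤ 0) ∧ ∀ y ∈ Y, p x y ≤ 0}

end

/-
The affine inequalities `⟪ξ, x⟫ ≤ α` valid on the feasible region `K` form the epigraph `S` of the
support function of `K`. By the sandwich theorem, `h ≥ 0` on `K` exactly when some affine minorant
of `h` is nonnegative on `K`, that is, when `0 ∈ epi h* + S`. By Farkas' lemma, `S` is the closure
of any convex cone of valid inequalities whose solution set is `K`, provided the cone contains
`(0, 1)`. The affine minorants of the constraint functions already cut out `K`, and Dirac measures
put those of `p(·, y)` into `C₁`, whence `S = cl (C₁ + C₂)`.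
-/

section Separation

variable {E : Type*} [AddCommGroup E] [Module ℝ E] [TopologicalSpace E]

theorem strongDual_prod_real_apply (L : StrongDual ℝ (E × ℝ)) (x : E) (r : ℝ) :
    L (x, r) = L (x, 0) + r * L (0, 1) := by
  rw [← smul_eq_mul, ← map_smul, ← map_add]
  simp

theorem exists_affine_between_concaveOn_convexOn [IsTopologicalAddGroup E] [ContinuousSMul ℝ E]
    {f g : E → ℝ} {K : Set E} (f_cont : Continuous f) (f_conv : ConvexOn ℝ Set.univ f)
    (g_conc : ConcaveOn ℝ K g) (K_nonempty : K.Nonempty) (hgf : ∀ x ∈ K, g x ≤ f x) :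
    ∃ (φ : StrongDual ℝ E) (c : ℝ), (∀ x, φ x + c ≤ f x) ∧ ∀ x ∈ K, g x ≤ φ x + c := by
  have epi_conv : Convex ℝ {z : E × ℝ | f z.1 < z.2} := by
    simpa using f_conv.convex_strict_epigraph
  have epi_open : IsOpen {z : E × ℝ | f z.1 < z.2} :=
    isOpen_lt (f_cont.comp continuous_fst) continuous_snd
  have disjoint_epi_hypo :
      Disjoint {z : E × ℝ | f z.1 < z.2} {z : E × ℝ | z.1 ∈ K ∧ z.2 ≤ g z.1} :=
    Set.disjoint_left.2 fun z hfz ⟨hzK, hzg⟩ => (hzg.trans (hgf z.1 hzK)).not_gt hfz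
  obtain ⟨L, u, hLf, hLg⟩ :=
    geometric_hahn_banach_open epi_conv epi_open g_conc.convex_hypograph disjoint_epi_hypo
  set t := L (0, 1)
  have above : ∀ x r, f x < r → L (x, 0) + r * t < u := fun x r hr => by
    simpa only [strongDual_prod_real_apply L x r] using hLf (x, r) hr
  have below : ∀ x ∈ K, u ≤ L (x, 0) + g x * t := fun x hx => by
    simpa only [strongDual_prod_real_apply L x (g x)] using hLg (x, g x) ⟨hx, le_rfl⟩
  have t_neg : t < 0 := by
    obtain ⟨x, hx⟩ := K_nonempty
    have mul_neg : (f x + 1 - g x) * t < 0 := by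
      linarith [above x (f x + 1) (lt_add_one _), below x hx]
    exact neg_of_mul_neg_right mul_neg (by linarith [hgf x hx])
  have eval : ∀ x, ((-t)⁻¹ • L.comp (.inl ℝ E ℝ)) x + -u / -t = (L (x, 0) - u) / -t := fun x => by
    simp only [smul_apply, ContinuousLinearMap.comp_apply, ContinuousLinearMap.inl_apply,
      smul_eq_mul]
    ring
  refine ⟨(-t)⁻¹ • L.comp (.inl ℝ E ℝ), -u / -t, fun x => ?_, fun x hx => ?_⟩
  · rw [eval]
    refine le_of_forall_gt_imp_ge_of_dense fun r hr => ?_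
    rw [div_le_iff₀ (neg_pos.2 t_neg)]
    linarith [above x r hr]
  · rw [eval, le_div_iff₀ (neg_pos.2 t_neg)]
    linarith [below x hx]

end Separation

section LinearInequalities

variable {E : Type*} [NormedAddCommGroup E] [InnerProductSpace ℝ E]

/-- The solution set of a system of affine inequalities, where the pair `(ξ, α)` encodes the
inequality `⟪ξ, x⟫ ≤ α`. -/
def solutionSet (C : Set (E × ℝ)) : Set E :=
  {x | ∀ q ∈ C, inner ℝ q.1 x ≤ q.2}

/-- The epigraph of the support function of `K`: the pairs `(ξ, α)` for which the affine
inequality `⟪ξ, x⟫ ≤ α` is valid on `K`. -/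
def supportEpigraph (K : Set E) : Set (E × ℝ) :=
  {q | ∀ x ∈ K, inner ℝ q.1 x ≤ q.2}

theorem subset_supportEpigraph_iff {C : Set (E × ℝ)} {K : Set E} :
    C ⊆ supportEpigraph K ↔ K ⊆ solutionSet C :=
  ⟨fun hCK _ hx _ hq => hCK hq _ hx, fun hKC _ hq _ hx => hKC hx _ hq⟩

theorem solutionSet_anti {C C' : Set (E × ℝ)} (hC : C ⊆ C') : solutionSet C' ⊆ solutionSet C :=
  fun _ hx _ hq => hx _ (hC hq)

theorem supportEpigraph_anti {K K' : Set E} (hK : K ⊆ K') :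
    supportEpigraph K' ⊆ supportEpigraph K :=
  fun _ hq _ hx => hq _ (hK hx)

theorem isClosed_supportEpigraph (K : Set E) : IsClosed (supportEpigraph K) := by
  simp only [supportEpigraph, Set.ofPred_forall]
  exact isClosed_biInter fun x _ =>
    isClosed_le (continuous_fst.inner continuous_const) continuous_snd

theorem exists_mem_solutionSet_lt_inner [CompleteSpace E] {C : PointedCone ℝ (E × ℝ)}
    (hC : (0, 1) ∈ C) (C_solvable : (solutionSet (C : Set (E × ℝ))).Nonempty) {q : E × ℝ}
    (hq : q ∉ closure (C : Set (E × ℝ))) :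
    ∃ x ∈ solutionSet (C : Set (E × ℝ)), q.2 < inner ℝ q.1 x := by
  obtain ⟨z, hz⟩ := C_solvable
  obtain ⟨L, hLC, hLq⟩ :=
    ProperCone.hyperplane_separation_point ⟨C.closure, isClosed_closure⟩ hq
  replace hLC : ∀ a ∈ C, 0 ≤ L a := fun a ha => hLC a (subset_closure ha)
  set w := (InnerProductSpace.toDual ℝ E).symm (L.comp (.inl ℝ E ℝ))
  have hL : ∀ a, L a = inner ℝ a.1 w + a.2 * L (0, 1) := fun a => by
    rw [real_inner_comm, InnerProductSpace.toDual_symm_apply]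
    exact strongDual_prod_real_apply L a.1 a.2
  set t := L (0, 1)
  -- `L` may be vertical (`t = 0`); tilting it by the slack at `z` makes it non-vertical while
  -- keeping it nonnegative on `C` and negative at `q`.
  obtain ⟨ε, ε_pos, hε⟩ := exists_pos_mul_lt (neg_pos.2 hLq) (q.2 - inner ℝ q.1 z)
  have t_add_pos : 0 < t + ε := add_pos_of_nonneg_of_pos (hLC _ hC) ε_pos
  set x := (t + ε)⁻¹ • (ε • z - w)
  have slack_x : ∀ a : E × ℝ,
      (t + ε) * (a.2 - inner ℝ a.1 x) = L a + (a.2 - inner ℝ a.1 z) * ε := fun a => by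
    rw [hL, real_inner_smul_right, inner_sub_right, real_inner_smul_right, mul_sub,
      mul_inv_cancel_left₀ t_add_pos.ne']
    ring
  refine ⟨x, fun a ha => ?_, ?_⟩
  · have slack_z : 0 ≤ (a.2 - inner ℝ a.1 z) * ε :=
      mul_nonneg (sub_nonneg.2 (hz a ha)) ε_pos.le
    exact sub_nonneg.1 (nonneg_of_mul_nonneg_right
      ((add_nonneg (hLC a ha) slack_z).trans_eq (slack_x a).symm) t_add_pos)
  · exact sub_neg.1 (neg_of_mul_neg_right ((slack_x q).trans_lt (by linarith)) t_add_pos.le)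

theorem closure_eq_supportEpigraph_solutionSet [CompleteSpace E] {C : PointedCone ℝ (E × ℝ)}
    (hC : (0, 1) ∈ C) (C_solvable : (solutionSet (C : Set (E × ℝ))).Nonempty) :
    closure (C : Set (E × ℝ)) = supportEpigraph (solutionSet (C : Set (E × ℝ))) := by
  refine (closure_minimal (subset_supportEpigraph_iff.2 subset_rfl)
    (isClosed_supportEpigraph _)).antisymm fun q hq => ?_
  by_contra hqC
  obtain ⟨x, hxC, hqx⟩ := exists_mem_solutionSet_lt_inner hC C_solvable hqC
  exact hqx.not_ge (hq x hxC)

end LinearInequalities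

section Conjugate

variable {m : ℕ}

theorem mem_epiConj_iff {f : Euc m → ℝ} {q : Euc m × ℝ} :
    q ∈ epiConj f ↔ ∀ x, inner ℝ q.1 x - q.2 ≤ f x := by
  simp only [epiConj, epigraph, conjugate, Set.mem_ofPred_eq, iSup_le_iff, ← EReal.coe_sub,
    EReal.coe_le_coe_iff, sub_le_comm]

theorem add_mem_epiConj_add {f g : Euc m → ℝ} {q r : Euc m × ℝ} (hq : q ∈ epiConj f)
    (hr : r ∈ epiConj g) : q + r ∈ epiConj (f + g) := by
  refine mem_epiConj_iff.2 fun x => ?_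
  rw [Prod.fst_add, Prod.snd_add, inner_add_left, add_sub_add_comm]
  exact add_le_add (mem_epiConj_iff.1 hq x) (mem_epiConj_iff.1 hr x)

theorem smul_mem_epiConj_smul {f : Euc m → ℝ} {q : Euc m × ℝ} {c : ℝ} (hc : 0 ≤ c)
    (hq : q ∈ epiConj f) : c • q ∈ epiConj (c • f) := by
  refine mem_epiConj_iff.2 fun x => ?_
  rw [Prod.smul_fst, Prod.smul_snd, real_inner_smul_left, smul_eq_mul, ← mul_sub]
  exact mul_le_mul_of_nonneg_left (mem_epiConj_iff.1 hq x) hc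

theorem mem_epiConj_zero {α : ℝ} (hα : 0 ≤ α) : ((0, α) : Euc m × ℝ) ∈ epiConj 0 :=
  mem_epiConj_iff.2 fun x => by simpa using hα

theorem exists_mem_epiConj_forall_le {f g : Euc m → ℝ} {K : Set (Euc m)}
    (f_conv : ConvexOn ℝ Set.univ f) (g_conc : ConcaveOn ℝ K g) (K_nonempty : K.Nonempty)
    (hgf : ∀ x ∈ K, g x ≤ f x) : ∃ q ∈ epiConj f, ∀ x ∈ K, g x ≤ inner ℝ q.1 x - q.2 := by
  have f_cont : Continuous f := continuousOn_univ.1 (f_conv.continuousOn isOpen_univ)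
  obtain ⟨φ, c, hφf, hgφ⟩ :=
    exists_affine_between_concaveOn_convexOn f_cont f_conv g_conc K_nonempty hgf
  refine ⟨((InnerProductSpace.toDual ℝ (Euc m)).symm φ, -c), mem_epiConj_iff.2 ?_, ?_⟩ <;>
    simpa only [InnerProductSpace.toDual_symm_apply, sub_neg_eq_add]

theorem solutionSet_epiConj {f : Euc m → ℝ} (f_conv : ConvexOn ℝ Set.univ f) :
    solutionSet (epiConj f) = {x | f x ≤ 0} := by
  ext x
  refine ⟨fun hx => ?_, fun hx q hq => sub_nonpos.1 ((mem_epiConj_iff.1 hq x).trans hx)⟩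
  obtain ⟨q, hq, hqx⟩ := exists_mem_epiConj_forall_le f_conv
    (concaveOn_const (f x) (convex_singleton x)) (Set.singleton_nonempty x) (by simp)
  exact (hqx x rfl).trans (sub_nonpos.2 (hx q hq))

theorem zero_mem_epiConj_add_supportEpigraph_iff {f : Euc m → ℝ} {K : Set (Euc m)}
    (f_conv : ConvexOn ℝ Set.univ f) (K_conv : Convex ℝ K) (K_nonempty : K.Nonempty) :
    (0 : Euc m × ℝ) ∈ epiConj f + supportEpigraph K ↔ ∀ x ∈ K, 0 ≤ f x := by
  constructor
  · rintro ⟨q, hq, r, hr, hqr⟩ x hx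
    obtain rfl : r = -q := (neg_eq_of_add_eq_zero_right hqr).symm
    have h_valid : -inner ℝ q.1 x ≤ -q.2 := by simpa using hr x hx
    linarith [mem_epiConj_iff.1 hq x]
  · intro f_nonneg
    obtain ⟨q, hq, hqK⟩ := exists_mem_epiConj_forall_le f_conv (concaveOn_const 0 K_conv)
      K_nonempty f_nonneg
    exact ⟨q, hq, -q, fun x hx => by simpa using hqK x hx, add_neg_cancel q⟩

/-- The union of the sets `epi f*` over a convex cone `F` of functions, itself a convex cone. -/
def epiConjCone (F : PointedCone ℝ (Euc m → ℝ)) : PointedCone ℝ (Euc m × ℝ) where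
  carrier := ⋃ f ∈ F, epiConj f
  zero_mem' := Set.mem_biUnion F.zero_mem (mem_epiConj_zero le_rfl)
  add_mem' := by
    simp only [Set.mem_iUnion₂]
    rintro q r ⟨f, hf, hq⟩ ⟨g, hg, hr⟩
    exact ⟨f + g, F.add_mem hf hg, add_mem_epiConj_add hq hr⟩
  smul_mem' := by
    simp only [Set.mem_iUnion₂]
    rintro c q ⟨f, hf, hq⟩
    exact ⟨c • f, Submodule.smul_mem F c hf, smul_mem_epiConj_smul c.2 hq⟩

theorem epiConj_subset_epiConjCone {F : PointedCone ℝ (Euc m → ℝ)} {f : Euc m → ℝ} (hf : f ∈ F) :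
    epiConj f ⊆ epiConjCone F :=
  Set.subset_biUnion_of_mem (u := epiConj) hf

theorem zero_one_mem_epiConjCone (F : PointedCone ℝ (Euc m → ℝ)) : (0, 1) ∈ epiConjCone F :=
  epiConj_subset_epiConjCone F.zero_mem (mem_epiConj_zero zero_le_one)

end Conjugate

section Feasibility

variable {m n s : ℕ}

/-- The functions `∫_Y p(·, y) dμ(y)` for finite measures `μ` on `Y` that integrate every `p(x, ·)`.
The integrability condition excludes the measures whose integrals in `coneC₁` take the junk
value `0`. -/
def integralCone (p : Euc m → Euc n → ℝ) (Y : Set (Euc n)) : PointedCone ℝ (Euc m → ℝ) where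
  carrier := {f | ∃ μ ∈ measuresOn Y,
    (∀ x, IntegrableOn (p x) Y μ) ∧ f = fun x => ∫ y in Y, p x y ∂μ}
  zero_mem' := ⟨0, ⟨inferInstance, rfl⟩, fun _ => by simp [IntegrableOn], by ext; simp⟩
  add_mem' := by
    rintro _ _ ⟨μ, ⟨_, hμY⟩, hμ, rfl⟩ ⟨ν, ⟨_, hνY⟩, hν, rfl⟩
    refine ⟨μ + ν, ⟨inferInstance, by simp [hμY, hνY]⟩, fun x => (hμ x).add_measure (hν x), ?_⟩
    ext x
    rw [Measure.restrict_add, integral_add_measure (hμ x) (hν x), Pi.add_apply]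
  smul_mem' := by
    rintro c _ ⟨μ, ⟨_, hμY⟩, hμ, rfl⟩
    let c' : NNReal := c
    refine ⟨c' • μ, ⟨inferInstance, by simp [hμY]⟩, fun x => ?_, ?_⟩
    · rw [IntegrableOn, Measure.restrict_smul]
      exact (hμ x).smul_measure_nnreal
    · ext x
      rw [Measure.restrict_smul, integral_smul_nnreal_measure]
      rfl

theorem mem_integralCone_of_mem (p : Euc m → Euc n → ℝ) {Y : Set (Euc n)} {y : Euc n}
    (hy : y ∈ Y) : (fun x => p x y) ∈ integralCone p Y := by
  classical
  refine ⟨Measure.dirac y, ⟨inferInstance, by simp [hy]⟩, fun x => ?_, ?_⟩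
  · exact (integrable_dirac (by simp)).integrableOn
  · ext x
    rw [setIntegral_dirac, if_pos hy]

theorem epiConjCone_integralCone_subset_coneC₁ (p : Euc m → Euc n → ℝ) (Y : Set (Euc n)) :
    (epiConjCone (integralCone p Y) : Set (Euc m × ℝ)) ⊆ coneC₁ p Y := by
  refine Set.iUnion₂_subset ?_
  rintro _ ⟨μ, hμY, -, rfl⟩
  exact Set.subset_biUnion_of_mem (u := fun μ => epiConj fun x => ∫ y in Y, p x y ∂μ) hμY

theorem epiConjCone_hull_subset_coneC₂ (ψ : Fin s → Euc m → ℝ) :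
    (epiConjCone (PointedCone.hull ℝ (Set.range ψ)) : Set (Euc m × ℝ)) ⊆ coneC₂ ψ := by
  refine Set.iUnion₂_subset fun f hf => ?_
  obtain ⟨η, rfl⟩ := (Submodule.mem_span_range_iff_exists_fun _).1 hf
  have h_sum : ∑ j, η j • ψ j = fun x => ∑ j, (η j : ℝ) * ψ j x := by
    ext x
    simp only [Finset.sum_apply]
    rfl
  rw [h_sum]
  exact Set.subset_biUnion_of_mem (u := fun η : Fin s → ℝ => epiConj fun x => ∑ j, η j * ψ j x)
    fun j => (η j).2

theorem coneC₁_add_coneC₂_subset_supportEpigraph (ψ : Fin s → Euc m → ℝ)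
    (p : Euc m → Euc n → ℝ) (Y : Set (Euc n)) :
    coneC₁ p Y + coneC₂ ψ ⊆ supportEpigraph (feasibleSet ψ p Y) := by
  rintro _ ⟨q, hq, r, hr, rfl⟩ x ⟨hxψ, hxp⟩
  obtain ⟨μ, ⟨_, hμY⟩, hq⟩ := Set.mem_iUnion₂.1 hq
  obtain ⟨η, hη, hr⟩ := Set.mem_iUnion₂.1 hr
  have integral_nonpos : ∫ y in Y, p x y ∂μ ≤ 0 := by
    have ae_mem : ∀ᵐ y ∂μ, y ∈ Y := hμY
    exact integral_nonpos_of_ae ((ae_restrict_of_ae ae_mem).mono hxp)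
  have sum_nonpos : ∑ j, η j * ψ j x ≤ 0 :=
    Finset.sum_nonpos fun j _ => mul_nonpos_of_nonneg_of_nonpos (hη j) (hxψ j)
  rw [Prod.fst_add, Prod.snd_add, inner_add_left]
  linarith [mem_epiConj_iff.1 hq x, mem_epiConj_iff.1 hr x]

theorem solutionSet_subset_feasibleSet {ψ : Fin s → Euc m → ℝ} {p : Euc m → Euc n → ℝ}
    {Y : Set (Euc n)} (ψ_conv : ∀ j, ConvexOn ℝ Set.univ (ψ j))
    (p_conv : ∀ y ∈ Y, ConvexOn ℝ Set.univ fun x => p x y) {C : Set (Euc m × ℝ)}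
    (hψC : ∀ j, epiConj (ψ j) ⊆ C) (hpC : ∀ y ∈ Y, epiConj (fun x => p x y) ⊆ C) :
    solutionSet C ⊆ feasibleSet ψ p Y :=
  fun _ hx => ⟨fun j => (solutionSet_epiConj (ψ_conv j)).subset (solutionSet_anti (hψC j) hx),
    fun y hy => (solutionSet_epiConj (p_conv y hy)).subset (solutionSet_anti (hpC y hy) hx)⟩

theorem closure_coneC₁_add_coneC₂ {ψ : Fin s → Euc m → ℝ} {p : Euc m → Euc n → ℝ}
    {Y : Set (Euc n)} (ψ_conv : ∀ j, ConvexOn ℝ Set.univ (ψ j))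
    (p_conv : ∀ y ∈ Y, ConvexOn ℝ Set.univ fun x => p x y)
    (K_nonempty : (feasibleSet ψ p Y).Nonempty) :
    closure (coneC₁ p Y + coneC₂ ψ) = supportEpigraph (feasibleSet ψ p Y) := by
  let F₁ := integralCone p Y
  let F₂ := PointedCone.hull ℝ (Set.range ψ)
  let D := epiConjCone F₁ ⊔ epiConjCone F₂
  have hF₁D : epiConjCone F₁ ≤ D := le_sup_left
  have hF₂D : epiConjCone F₂ ≤ D := le_sup_right
  have D_subset : (D : Set (Euc m × ℝ)) ⊆ coneC₁ p Y + coneC₂ ψ := by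
    rw [Submodule.coe_sup]
    exact Set.add_subset_add (epiConjCone_integralCone_subset_coneC₁ p Y)
      (epiConjCone_hull_subset_coneC₂ ψ)
  have sum_valid := coneC₁_add_coneC₂_subset_supportEpigraph ψ p Y
  have solutions_feasible : solutionSet (D : Set (Euc m × ℝ)) ⊆ feasibleSet ψ p Y :=
    solutionSet_subset_feasibleSet ψ_conv p_conv
      (fun j => (epiConj_subset_epiConjCone
        (PointedCone.subset_hull (Set.mem_range_self j))).trans hF₂D)
      (fun y hy => (epiConj_subset_epiConjCone (mem_integralCone_of_mem p hy)).trans hF₁D)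
  have D_solvable : (solutionSet (D : Set (Euc m × ℝ))).Nonempty :=
    K_nonempty.mono (subset_supportEpigraph_iff.1 (D_subset.trans sum_valid))
  refine (closure_minimal sum_valid (isClosed_supportEpigraph _)).antisymm ?_
  calc supportEpigraph (feasibleSet ψ p Y)
      ⊆ supportEpigraph (solutionSet D) := supportEpigraph_anti solutions_feasible
    _ = closure D := (closure_eq_supportEpigraph_solutionSet
        (hF₁D (zero_one_mem_epiConjCone F₁)) D_solvable).symm
    _ ⊆ closure (coneC₁ p Y + coneC₂ ψ) := closure_mono D_subset

theorem convex_feasibleSet {ψ : Fin s → Euc m → ℝ} {p : Euc m → Euc n → ℝ} {Y : Set (Euc n)}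
    (ψ_conv : ∀ j, ConvexOn ℝ Set.univ (ψ j))
    (p_conv : ∀ y ∈ Y, ConvexOn ℝ Set.univ fun x => p x y) :
    Convex ℝ (feasibleSet ψ p Y) := by
  simp only [feasibleSet, Set.ofPred_and, Set.ofPred_forall]
  refine (convex_iInter fun j => ?_).inter (convex_iInter₂ fun y hy => ?_)
  · simpa using (ψ_conv j).convex_le 0
  · simpa using (p_conv y hy).convex_le 0

end Feasibility

theorem mainTheorem8_general {m n s : ℕ} (h : Euc m → ℝ) (ψ : Fin s → Euc m → ℝ)
    (p : Euc m → Euc n → ℝ) (Y : Set (Euc n)) (h_conv : ConvexOn ℝ Set.univ h)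
    (ψ_conv : ∀ j, ConvexOn ℝ Set.univ (ψ j))
    (p_conv : ∀ y ∈ Y, ConvexOn ℝ Set.univ fun x => p x y)
    (K_nonempty : (feasibleSet ψ p Y).Nonempty) :
    Xor (∃ x : Euc m, h x < 0 ∧ (∀ j, ψ j x ≤ 0) ∧ ∀ y ∈ Y, p x y ≤ 0)
      (((0, 0) : Euc m × ℝ) ∈ epiConj h + closure (coneC₁ p Y + coneC₂ ψ)) := by
  have certificate_iff := zero_mem_epiConj_add_supportEpigraph_iff h_conv
    (convex_feasibleSet ψ_conv p_conv) K_nonempty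
  rw [closure_coneC₁_add_coneC₂ ψ_conv p_conv K_nonempty, Prod.mk_zero_zero, certificate_iff,
    xor_iff_iff_not]
  push Not
  exact exists_congr fun x => and_comm

theorem mainTheorem8 {m n s : ℕ} (h : Euc m → ℝ) (ψ : Fin s → Euc m → ℝ)
    (p : Euc m → Euc n → ℝ) (Y : Set (Euc n))
    (h_cont : Continuous h) (h_conv : ConvexOn ℝ Set.univ h)
    (ψ_cont : ∀ j, Continuous (ψ j)) (ψ_conv : ∀ j, ConvexOn ℝ Set.univ (ψ j))
    (p_cont_left : ∀ y ∈ Y, Continuous fun x => p x y)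
    (p_conv : ∀ y ∈ Y, ConvexOn ℝ Set.univ fun x => p x y)
    (p_lsc : LowerSemicontinuous fun z : Euc m × Euc n => p z.1 z.2)
    (p_cont_right : ∀ x, Continuous (p x))
    (Y_compact : IsCompact Y)
    (K_nonempty : (feasibleSet ψ p Y).Nonempty) :
    Xor (∃ x : Euc m, h x < 0 ∧ (∀ j, ψ j x ≤ 0) ∧ ∀ y ∈ Y, p x y ≤ 0)
      (((0, 0) : Euc m × ℝ) ∈ epiConj h + closure (coneC₁ p Y + coneC₂ ψ)) :=
  mainTheorem8_general h ψ p Y h_conv ψ_conv p_conv K_nonempty
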